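/- **Theorem 3.** Let $n_1,n_2,m_1,m_2$ be non-negative integers and let $\mathbf{x}=(\mathbf{x}_1,\mathbf{x}_2)$, with $\mathbf{x}_1\in\mathbb{R}^{n_1}$ and $\mathbf{x}_2\in\mathbb{R}^{n_2}$, be jointly Gaussian with distribution $\mathcal{N}(\boldsymbol{\mu}_{\mathbf{x}},\mathbf{\Sigma}_{\mathbf{x}})$, where $\mathbf{\Sigma}_{\mathbf{x}}=\begin{bmatrix}\mathbf{\Sigma}_{\mathbf{x}_1}&\mathbf{\Sigma}_{\mathbf{x}_{12}}\\ \mathbf{\Sigma}_{\mathbf{x}_{21}}&\mathbf{\Sigma}_{\mathbf{x}_2}\end{bmatrix}$ is an arbitrary (possibly singular) positive semidefinite matrix. Let $r_{\mathbf{x}_1}=\operatorname{rank}\mathbf{\Sigma}_{\mathbf{x}_1}$, $r_{\mathbf{x}_2}=\operatorname{rank}\mathbf{\Sigma}_{\mathbf{x}_2}$ and $r_{\mathbf{x}}=\operatorname{rank}\mathbf{\Sigma}_{\mathbf{x}}$. Observe $$\mathbf{y}_1=\mathbf{\Phi}_1\mathbf{x}_1+\mathbf{w}_1,\qquad \mathbf{y}_2=\mathbf{\Phi}_2\mathbf{x}_2+\mathbf{w}_2,$$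 where $\mathbf{w}_i\sim\mathcal{N}(\mathbf{0},\sigma^2\mathbf{I})$ in $\mathbb{R}^{m_i}$, the vectors $\mathbf{x},\mathbf{w}_1,\mathbf{w}_2$ are independent, and $\mathbf{\Phi}_1\in\mathbb{R}^{m_1\times n_1}$, $\mathbf{\Phi}_2\in\mathbb{R}^{m_2\times n_2}$ are random matrices, independent of each other and of $(\mathbf{x},\mathbf{w}_1,\mathbf{w}_2)$. Assume that each $\mathbf{\Phi}_i$ is left rotation-invariant, i.e., its entries have a joint probability density $p_i$ with $p_i(\mathbf{\Theta}\mathbf{A})=p_i(\mathbf{A})$ (for almost every $\mathbf{A}$) for every orthogonal $m_i\times m_i$ matrix $\mathbf{\Theta}$. For a given realization of $(\mathbf{\Phi}_1,\mathbf{\Phi}_2)$ and $\sigma^2>0$, let $$\mathsf{MMSE}_{1|1,2}(\sigma^2)=\mathbb{E}\bigl[\|\mathbf{x}_1-\mathbb{E}[\mathbf{x}_1\mid\mathbf{y}_1,\mathbf{y}_2]\|^2\bigr],$$ where the expectations are over $(\mathbf{x},\mathbf{w}_1,\mathbf{w}_2)$ and $\|\cdot\|$ is the Euclidean norm. Then,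 with probability 1 with respect to $(\mathbf{\Phi}_1,\mathbf{\Phi}_2)$, $$\lim_{\sigma^2\to0^+}\mathsf{MMSE}_{1|1,2}(\sigma^2)=0\iff m_1\ge r_{\mathbf{x}_1}\ \text{ or }\ \bigl(m_1\ge r_{\mathbf{x}}-r_{\mathbf{x}_2}\ \text{ and }\ m_1+m_2\ge r_{\mathbf{x}}\bigr).$$ -/

import Mathlib

open MeasureTheory ProbabilityTheory Filter Topology
open scoped ENNReal

noncomputable section

namespace SideInformation

/-- The entries of a matrix-valued random variable, as a function of the sample point. -/
def entries {Ω : Type*} {m n : ℕ} (Φ : Ω → Matrix (Fin m) (Fin n) ℝ) :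
    Ω → Fin m → Fin n → ℝ :=
  fun ω i j => Φ ω i j

/-- A random `m × n` matrix `Φ` is left rotation-invariant: its entries have a joint probability
density `p` (with respect to Lebesgue measure on `ℝ^(m × n)`) with `p (Θ A) = p A` for every
orthogonal `m × m` matrix `Θ`.  A density is determined only up to null sets, so the identity is
required for almost every `A`. -/
def IsLeftRotationInvariant {Ω : Type*} [MeasurableSpace Ω] (P : Measure Ω) {m n : ℕ}
    (Φ : Ω → Matrix (Fin m) (Fin n) ℝ) : Prop :=
  ∃ p : (Fin m → Fin n → ℝ) → ℝ≥0∞, Measurable p ∧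
    P.map (entries Φ) = (volume : Measure (Fin m → Fin n → ℝ)).withDensity p ∧
    ∀ Θ ∈ Matrix.orthogonalGroup (Fin m) ℝ,
      ∀ᵐ A : Fin m → Fin n → ℝ, p (fun i j => (Θ * Matrix.of A) i j) = p A

/-- The minimum mean-squared error `𝔼 ‖u - 𝔼[u | v]‖²` of estimating the random vector `u` from the
observation `v`, i.e. the mean-squared error of the conditional mean estimator.  It takes values in
`[0, ∞]`. -/
def mmse {S E F : Type*} [MeasurableSpace S] [NormedAddCommGroup E] [NormedSpace ℝ E]
    [CompleteSpace E] [mF : MeasurableSpace F] (Q : Measure S) (u : S → E) (v : S → F) : ℝ≥0∞ :=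
  ∫⁻ s, ‖u s - (Q[u | MeasurableSpace.comap v mF]) s‖ₑ ^ 2 ∂Q

/-- Sample space of the source and noise vectors: a point is `(x, (w₁, w₂))`, where
`x = (x₁, x₂) ∈ ℝ^(n₁ + n₂)` is the concatenation of signal and side information, and
`w₁ ∈ ℝ^m₁`, `w₂ ∈ ℝ^m₂` are the noise vectors. -/
abbrev Sample (n₁ n₂ m₁ m₂ : ℕ) : Type :=
  EuclideanSpace ℝ (Fin n₁ ⊕ Fin n₂) × (EuclideanSpace ℝ (Fin m₁) × EuclideanSpace ℝ (Fin m₂))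

/-- The joint law of `(x, w₁, w₂)`: `x ∼ 𝒩(μ, C)`, `w₁ ∼ 𝒩(0, v I)`, `w₂ ∼ 𝒩(0, v I)`, independent,
where `v = σ²` is the noise variance. -/
def sampleLaw {n₁ n₂ : ℕ} (m₁ m₂ : ℕ) (μ : EuclideanSpace ℝ (Fin n₁ ⊕ Fin n₂))
    (C : Matrix (Fin n₁ ⊕ Fin n₂) (Fin n₁ ⊕ Fin n₂) ℝ) (v : ℝ) :
    Measure (Sample n₁ n₂ m₁ m₂) :=
  (multivariateGaussian μ C).prod
    ((multivariateGaussian 0 (v • (1 : Matrix (Fin m₁) (Fin m₁) ℝ))).prod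
      (multivariateGaussian 0 (v • (1 : Matrix (Fin m₂) (Fin m₂) ℝ))))

variable {n₁ n₂ m₁ m₂ : ℕ}

/-- The signal of interest `x₁`. -/
def signal (s : Sample n₁ n₂ m₁ m₂) : EuclideanSpace ℝ (Fin n₁) :=
  WithLp.toLp 2 fun i => s.1 (Sum.inl i)

/-- The side information signal `x₂`. -/
def side (s : Sample n₁ n₂ m₁ m₂) : EuclideanSpace ℝ (Fin n₂) :=
  WithLp.toLp 2 fun i => s.1 (Sum.inr i)

/-- The noisy features `(y₁, y₂)`, with `y₁ = A₁ x₁ + w₁` and `y₂ = A₂ x₂ + w₂`. -/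
def features (A₁ : Matrix (Fin m₁) (Fin n₁) ℝ) (A₂ : Matrix (Fin m₂) (Fin n₂) ℝ)
    (s : Sample n₁ n₂ m₁ m₂) : EuclideanSpace ℝ (Fin m₁) × EuclideanSpace ℝ (Fin m₂) :=
  (A₁.toEuclideanLin (signal s) + s.2.1, A₂.toEuclideanLin (side s) + s.2.2)

/-- `MMSE_{1|1,2}(v)`: the minimum mean-squared error of estimating `x₁` from `(y₁, y₂)` when the
noise variance is `v = σ²`, for given kernels `A₁` and `A₂` and `(x₁, x₂) ∼ 𝒩(μ, C)`. -/
def mmseSide (A₁ : Matrix (Fin m₁) (Fin n₁) ℝ) (A₂ : Matrix (Fin m₂) (Fin n₂) ℝ)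
    (μ : EuclideanSpace ℝ (Fin n₁ ⊕ Fin n₂))
    (C : Matrix (Fin n₁ ⊕ Fin n₂) (Fin n₁ ⊕ Fin n₂) ℝ) (v : ℝ) : ℝ≥0∞ :=
  mmse (sampleLaw m₁ m₂ μ C v) signal (features A₁ A₂)

end SideInformation

end

/-! With `L = CFC.sqrt C` and row blocks `L₁`, `L₂`, the source is `μ + L g` for a standard Gaussian
`g`. For fixed kernels the error vanishes with the noise iff every row of `L₁` lies in the joint row
space of `A₁ L₁` and `A₂ L₂` (`tendsto_mmseSide_iff`).

If it does, a fixed affine estimator is exact on noiseless features, and its error is filtered noise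
of energy `O(v)` (`tendsto_mmseSide`). If not, some `t` has `A₁ L₁ t = 0`, `A₂ L₂ t = 0`, `L₁ t ≠
0`. Flipping the `t`-component of `g` preserves its law and the features but moves the signal, so
the error stays above a constant independent of `v` (`exists_pos_le_mmseSide`).

For Lebesgue-almost every pair of kernels the spans are as large as possible, so the inclusion
becomes a count of dimensions (`ae_range_le_sup_span_iff`); `L Lᵀ = C` turns these into ranks of
blocks of `C`. Independent kernels with densities avoid the exceptional null set. -/

noncomputable section

namespace SideInformation

/-! ### Dimensions of spans of generic vectors -/

section GenericSpan

open Module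

variable {E : Type*} [NormedAddCommGroup E] [NormedSpace ℝ E]

lemma finrank_span_range_le {n m : ℕ} (T : (Fin n → ℝ) →ₗ[ℝ] E) (A : Fin m → Fin n → ℝ) :
    finrank ℝ (Submodule.span ℝ (Set.range fun i => T (A i))) ≤ m := by
  have h := finrank_range_le_card (R := ℝ) fun i => T (A i)
  rwa [Fintype.card_fin] at h

lemma span_range_comp_le {n m : ℕ} (T : (Fin n → ℝ) →ₗ[ℝ] E) (A : Fin m → Fin n → ℝ) :
    Submodule.span ℝ (Set.range fun i => T (A i)) ≤ LinearMap.range T :=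
  Submodule.span_le.2 (by rintro _ ⟨i, rfl⟩; exact ⟨A i, rfl⟩)

variable [FiniteDimensional ℝ E]

/-- The dimension of the span of a finite family is lower semicontinuous. -/
lemma isOpen_setOf_le_finrank_span {ι : Type*} [Fintype ι] (k : ℕ) :
    IsOpen {v : ι → E | k ≤ finrank ℝ (Submodule.span ℝ (Set.range v))} := by
  -- `F v` sends coefficients to the linear combination of `v`; its rank is the dimension of the
  -- span, and rank at least `k` is an open condition.
  let F : (ι → E) →ₗ[ℝ] ((ι → ℝ) →L[ℝ] E) :=
    (LinearMap.toContinuousLinearMap (𝕜 := ℝ) (E := ι → ℝ) (F' := E)).toLinearMap ∘ₗ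
      Fintype.bilinearCombination ℝ ℝ
  have hF : Continuous F := F.continuous_of_finiteDimensional
  have h := (isOpen_setOfPred_nat_le_rank (𝕜 := ℝ) (E := ι → ℝ) (F := E) k).preimage hF
  convert h using 1
  ext v
  have hr : ((F v : (ι → ℝ) →L[ℝ] E) : (ι → ℝ) →ₗ[ℝ] E) = Fintype.linearCombination ℝ v := rfl
  rw [Set.mem_preimage, Set.mem_ofPred_eq, Set.mem_ofPred_eq, hr, LinearMap.rank,
    Fintype.range_linearCombination, ← finrank_eq_rank, Nat.cast_le]

/-- The dimension of `S ⊔ span v` is lower semicontinuous in the finite family `v`. -/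
lemma isOpen_setOf_le_finrank_sup_span {ι : Type*} [Fintype ι] (S : Submodule ℝ E) (k : ℕ) :
    IsOpen {v : ι → E | k ≤ finrank ℝ ↥(S ⊔ Submodule.span ℝ (Set.range v))} := by
  let b := finBasis ℝ S
  have hb : Submodule.span ℝ (Set.range fun i => (b i : E)) = S := by
    have : (Set.range fun i => (b i : E)) = S.subtype '' Set.range b := by
      rw [← Set.range_comp]; rfl
    rw [this, ← Submodule.map_span, b.span_eq, Submodule.map_top, Submodule.range_subtype]
  have hc : Continuous fun v : ι → E => (Sum.elim (fun i => (b i : E)) v : _ ⊕ ι → E) := by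
    refine continuous_pi fun i => ?_
    cases i
    · exact continuous_const
    · exact continuous_apply _
  convert (isOpen_setOf_le_finrank_span (E := E) k).preimage hc using 1
  ext v
  rw [Set.mem_preimage, Set.mem_ofPred_eq, Set.mem_ofPred_eq, Set.Sum.elim_range,
    Submodule.span_union, hb]

/-- A generic family of `m` vectors in the range of `T` is in general position with respect to a
subspace `S`. -/
lemma ae_min_le_finrank_sup_span {n : ℕ} (T : (Fin n → ℝ) →ₗ[ℝ] E) (m : ℕ) :
    ∀ S : Submodule ℝ E, ∀ᵐ A : Fin m → Fin n → ℝ,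
      min (finrank ℝ S + m) (finrank ℝ ↥(S ⊔ LinearMap.range T)) ≤
        finrank ℝ ↥(S ⊔ Submodule.span ℝ (Set.range fun i => T (A i))) := by
  have hTc : Continuous T := T.continuous_of_finiteDimensional
  induction m with
  | zero =>
    intro S
    refine Eventually.of_forall fun A => (min_le_left _ _).trans ?_
    exact Submodule.finrank_mono le_sup_left
  | succ m ih =>
    intro S
    set k := min (finrank ℝ S + (m + 1)) (finrank ℝ ↥(S ⊔ LinearMap.range T)) with hk
    let e := MeasurableEquiv.piFinSuccAbove (fun _ : Fin (m + 1) => Fin n → ℝ) 0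
    have he : MeasurePreserving e volume volume :=
      volume_preserving_piFinSuccAbove (fun _ : Fin (m + 1) => Fin n → ℝ) 0
    have key : ∀ᵐ z : (Fin n → ℝ) × (Fin m → Fin n → ℝ), k ≤ finrank ℝ ↥((S ⊔
        Submodule.span ℝ {T z.1}) ⊔ Submodule.span ℝ (Set.range fun i => T (z.2 i))) := by
      -- Lower semicontinuity supplies the measurability that Fubini requires. The first vector is
      -- then drawn alone, and induction applies to `S` enlarged by it.
      have hmeas : MeasurableSet {z : (Fin n → ℝ) × (Fin m → Fin n → ℝ) | k ≤ finrank ℝ ↥((S ⊔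
          Submodule.span ℝ {T z.1}) ⊔ Submodule.span ℝ (Set.range fun i => T (z.2 i)))} := by
        have hc : Continuous fun z : (Fin n → ℝ) × (Fin m → Fin n → ℝ) =>
            (Sum.elim (fun _ : Unit => T z.1) (fun i => T (z.2 i)) : Unit ⊕ Fin m → E) := by
          refine continuous_pi fun i => ?_
          cases i
          · exact hTc.comp continuous_fst
          · exact hTc.comp ((continuous_apply _).comp continuous_snd)
        have := ((isOpen_setOf_le_finrank_sup_span S k).preimage hc).measurableSet
        convert this using 1
        ext z
        rw [Set.mem_preimage, Set.mem_ofPred_eq, Set.mem_ofPred_eq, Set.Sum.elim_range,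
          Submodule.span_union, Set.range_const, sup_assoc]
      rw [Measure.volume_eq_prod, Measure.ae_prod_iff_ae_ae hmeas]
      have hfirst : ∀ᵐ a : Fin n → ℝ, min (finrank ℝ S + 1) (finrank ℝ ↥(S ⊔ LinearMap.range T)) ≤
          finrank ℝ ↥(S ⊔ Submodule.span ℝ {T a}) := by
        by_cases hTS : LinearMap.range T ≤ S
        · refine Eventually.of_forall fun a => (min_le_right _ _).trans ?_
          exact Submodule.finrank_mono (by rw [sup_eq_left.2 hTS]; exact le_sup_left)
        -- The first vector fails to enlarge `S` only on a proper subspace, which is Lebesgue-null.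
        · have hne : S.comap T ≠ ⊤ := by
            intro h
            exact hTS (LinearMap.range_le_iff_comap.2 h)
          have h0 := Measure.addHaar_submodule (volume : Measure (Fin n → ℝ)) _ hne
          filter_upwards [measure_eq_zero_iff_ae_notMem.1 h0] with a ha
          refine (min_le_left _ _).trans ?_
          refine Nat.succ_le_of_lt (Submodule.finrank_lt_finrank_of_lt ?_)
          refine lt_of_le_of_ne le_sup_left fun h => ha ?_
          have : T a ∈ S ⊔ Submodule.span ℝ {T a} :=
            (le_sup_right : _ ≤ S ⊔ Submodule.span ℝ {T a}) (Submodule.mem_span_singleton_self _)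
          rw [← h] at this
          exact this
      filter_upwards [hfirst] with a ha
      filter_upwards [ih (S ⊔ Submodule.span ℝ {T a})] with A hA
      have hsup : S ⊔ Submodule.span ℝ {T a} ⊔ LinearMap.range T = S ⊔ LinearMap.range T := by
        have h : Submodule.span ℝ {T a} ≤ LinearMap.range T :=
          (Submodule.span_singleton_le_iff_mem _ _).2 ⟨a, rfl⟩
        rw [sup_assoc, sup_eq_right.2 h]
      rw [hsup] at hA
      refine le_trans ?_ hA
      omega
    have := he.quasiMeasurePreserving.ae key
    filter_upwards [this] with A hA
    have hrange : (Set.range fun i => T (A i)) =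
        {T (e A).1} ∪ Set.range fun i => T ((e A).2 i) := by
      ext x
      simp only [Set.mem_range, Set.mem_union, Set.mem_singleton_iff, Fin.exists_fin_succ]
      exact or_congr_left eq_comm
    rw [hrange, Submodule.span_union, ← sup_assoc]
    exact hA

/-- For generic `A₁` and `A₂`, the range of `T₁` lies in the span of the images of the rows of `A₁`
under `T₁` and of the rows of `A₂` under `T₂` if and only if a rank condition holds. -/
lemma ae_range_le_sup_span_iff {n₁ n₂ m₁ m₂ : ℕ} (T₁ : (Fin n₁ → ℝ) →ₗ[ℝ] E)
    (T₂ : (Fin n₂ → ℝ) →ₗ[ℝ] E) :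
    ∀ᵐ A : (Fin m₁ → Fin n₁ → ℝ) × (Fin m₂ → Fin n₂ → ℝ),
      LinearMap.range T₁ ≤ Submodule.span ℝ (Set.range fun i => T₁ (A.1 i)) ⊔
          Submodule.span ℝ (Set.range fun i => T₂ (A.2 i)) ↔
        (finrank ℝ (LinearMap.range T₁) ≤ m₁ ∨
          (finrank ℝ ↥(LinearMap.range T₁ ⊔ LinearMap.range T₂) - finrank ℝ (LinearMap.range T₂)
            ≤ m₁ ∧ finrank ℝ ↥(LinearMap.range T₁ ⊔ LinearMap.range T₂) ≤ m₁ + m₂)) := by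
  have hTc₁ : Continuous T₁ := T₁.continuous_of_finiteDimensional
  have hTc₂ : Continuous T₂ := T₂.continuous_of_finiteDimensional
  set r := finrank ℝ ↥(LinearMap.range T₁ ⊔ LinearMap.range T₂) with hr
  set r₁ := finrank ℝ (LinearMap.range T₁) with hr₁
  set r₂ := finrank ℝ (LinearMap.range T₂) with hr₂
  have joint : ∀ᵐ A : (Fin m₁ → Fin n₁ → ℝ) × (Fin m₂ → Fin n₂ → ℝ),
      min (min (m₁ + m₂) (r₁ + m₂)) (min (r₂ + m₁) r) ≤
        finrank ℝ ↥(Submodule.span ℝ (Set.range fun i => T₁ (A.1 i)) ⊔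
          Submodule.span ℝ (Set.range fun i => T₂ (A.2 i))) := by
    set k := min (min (m₁ + m₂) (r₁ + m₂)) (min (r₂ + m₁) r) with hk
    have hmeas : MeasurableSet {A : (Fin m₁ → Fin n₁ → ℝ) × (Fin m₂ → Fin n₂ → ℝ) |
        k ≤ finrank ℝ ↥(Submodule.span ℝ (Set.range fun i => T₁ (A.1 i)) ⊔
          Submodule.span ℝ (Set.range fun i => T₂ (A.2 i)))} := by
      have hc : Continuous fun A : (Fin m₁ → Fin n₁ → ℝ) × (Fin m₂ → Fin n₂ → ℝ) =>
          (Sum.elim (fun i => T₁ (A.1 i)) (fun i => T₂ (A.2 i)) : Fin m₁ ⊕ Fin m₂ → E) := by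
        refine continuous_pi fun i => ?_
        cases i
        · exact hTc₁.comp ((continuous_apply _).comp continuous_fst)
        · exact hTc₂.comp ((continuous_apply _).comp continuous_snd)
      convert ((isOpen_setOf_le_finrank_span k).preimage hc).measurableSet using 1
      ext z
      rw [Set.mem_preimage, Set.mem_ofPred_eq, Set.mem_ofPred_eq, Set.Sum.elim_range,
        Submodule.span_union]
    rw [Measure.volume_eq_prod, Measure.ae_prod_iff_ae_ae hmeas]
    -- With `A₁` fixed, `h₃` bounds the dimension below by the smaller of `dim S₁ + m₂` and `dim (S₁
    -- ⊔ range T₂)`, where `S₁` is the span from `A₁`; `h₁` and `h₂` bound these two.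
    filter_upwards [ae_min_le_finrank_sup_span T₁ m₁ ⊥,
      ae_min_le_finrank_sup_span T₁ m₁ (LinearMap.range T₂)] with A₁ h₁ h₂
    filter_upwards [ae_min_le_finrank_sup_span T₂ m₂
      (Submodule.span ℝ (Set.range fun i => T₁ (A₁ i)))] with A₂ h₃
    rw [bot_sup_eq, bot_sup_eq, finrank_bot] at h₁
    rw [sup_comm (LinearMap.range T₂) (LinearMap.range T₁),
      sup_comm (LinearMap.range T₂)] at h₂
    refine le_trans ?_ h₃
    rw [← hr₁] at h₁
    rw [← hr₂, ← hr] at h₂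
    omega
  have single : ∀ᵐ A : (Fin m₁ → Fin n₁ → ℝ) × (Fin m₂ → Fin n₂ → ℝ),
      min (r₁ + m₂) r ≤ finrank ℝ ↥(LinearMap.range T₁ ⊔
          Submodule.span ℝ (Set.range fun i => T₂ (A.2 i))) :=
    Measure.quasiMeasurePreserving_snd.ae
      (ae_min_le_finrank_sup_span T₂ m₂ (LinearMap.range T₁))
  filter_upwards [joint, single] with A hj hs
  set S₁ := Submodule.span ℝ (Set.range fun i => T₁ (A.1 i)) with hS₁
  set S₂ := Submodule.span ℝ (Set.range fun i => T₂ (A.2 i)) with hS₂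
  have le₁ : S₁ ≤ LinearMap.range T₁ := span_range_comp_le T₁ A.1
  have le₂ : S₂ ≤ LinearMap.range T₂ := span_range_comp_le T₂ A.2
  have d₁ : finrank ℝ S₁ ≤ m₁ := finrank_span_range_le T₁ A.1
  have d₂ : finrank ℝ S₂ ≤ m₂ := finrank_span_range_le T₂ A.2
  have d₃ : finrank ℝ S₁ ≤ r₁ := Submodule.finrank_mono le₁
  have d₄ : finrank ℝ S₂ ≤ r₂ := Submodule.finrank_mono le₂
  have d₅ := Submodule.finrank_add_le_finrank_add_finrank S₁ S₂
  have d₆ := Submodule.finrank_add_le_finrank_add_finrank (LinearMap.range T₁) S₂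
  have d₇ : finrank ℝ ↥(LinearMap.range T₁ ⊔ S₂) ≤ r :=
    Submodule.finrank_mono (sup_le_sup_left le₂ _)
  have d₈ : r ≤ r₁ + r₂ := Submodule.finrank_add_le_finrank_add_finrank _ _
  have d₉ : r₁ ≤ r := Submodule.finrank_mono le_sup_left
  have d₁₀ : r₂ ≤ r := Submodule.finrank_mono le_sup_right
  have sub : S₁ ⊔ S₂ ≤ LinearMap.range T₁ ⊔ S₂ := sup_le_sup_right le₁ _
  have d₁₁ := Submodule.finrank_mono sub
  -- The bounds force `dim (range T₁ ⊔ S₂) = min (r₁ + m₂) r`, and `dim (S₁ ⊔ S₂)` is the minimum of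
  -- this with `m₁ + m₂` and `r₂ + m₁`. They agree if `m₁ ≥ r₁`; if `m₁ < r₁`, exactly when `r ≤ m₁
  -- + m₂` and `r ≤ r₂ + m₁`.
  have iff₁ : LinearMap.range T₁ ≤ S₁ ⊔ S₂ ↔
      finrank ℝ ↥(LinearMap.range T₁ ⊔ S₂) ≤ finrank ℝ ↥(S₁ ⊔ S₂) := by
    constructor
    · intro h
      exact Submodule.finrank_mono (sup_le h le_sup_right)
    · intro h
      rw [Submodule.eq_of_le_of_finrank_le sub h]
      exact le_sup_left
  rw [iff₁]
  omega

end GenericSpan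


open scoped MatrixOrder

/-! ### Two-sided estimates of the minimum mean-squared error -/

section Mmse

variable {S E F : Type*} [mS : MeasurableSpace S] [NormedAddCommGroup E] [NormedSpace ℝ E]
  [CompleteSpace E] [mF : MeasurableSpace F]

/-- The mean-squared error of any estimator `g` bounds the minimum mean-squared error, up to a
constant factor. -/
lemma mmse_le_four_mul {Q : Measure S} [IsFiniteMeasure Q] {u : S → E} {v : S → F} {g : F → E}
    (hv : Measurable v) (hg : StronglyMeasurable g) (hgi : Integrable (g ∘ v) Q)
    (hu : MemLp (fun s => u s - g (v s)) 2 Q) :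
    mmse Q u v ≤ 4 * ∫⁻ s, ‖u s - g (v s)‖ₑ ^ 2 ∂Q := by
  have hle : mF.comap v ≤ mS := hv.comap_le
  set h : S → E := fun s => u s - g (v s) with hh
  have hhi : Integrable h Q := hu.integrable one_le_two
  have hgm : StronglyMeasurable[mF.comap v] (g ∘ v) := hg.comp_measurable (comap_measurable v)
  have hdecomp : u = g ∘ v + h := by ext s; simp [hh]
  have hce : Q[u | mF.comap v] =ᵐ[Q] g ∘ v + Q[h | mF.comap v] := by
    have h1 := condExp_add hgi hhi (mF.comap v)
    rw [← hdecomp, condExp_of_stronglyMeasurable hle hgm hgi] at h1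
    exact h1
  have hres : (fun s => u s - (Q[u | mF.comap v]) s) =ᵐ[Q] h - Q[h | mF.comap v] := by
    filter_upwards [hce] with s hs
    rw [hs]
    simp only [hh, Pi.add_apply, Pi.sub_apply, Function.comp_apply]
    abel
  have hsq : ∀ f : S → E, ∫⁻ s, ‖f s‖ₑ ^ 2 ∂Q = eLpNorm f 2 Q ^ 2 := by
    intro f
    have := eLpNorm_nnreal_pow_eq_lintegral (μ := Q) (f := f) (p := 2) two_ne_zero
    simpa using this.symm
  -- `L²`-contractivity of conditional expectation replaces orthogonality, since `E` is only a
  -- Banach space; squaring the 2 gives the factor 4.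
  have hnorm : eLpNorm (fun s => u s - (Q[u | mF.comap v]) s) 2 Q ≤ 2 * eLpNorm h 2 Q := by
    rw [eLpNorm_congr_ae hres]
    calc eLpNorm (h - Q[h | mF.comap v]) 2 Q ≤ eLpNorm h 2 Q + eLpNorm (Q[h | mF.comap v]) 2 Q :=
          eLpNorm_sub_le hu.1 (stronglyMeasurable_condExp.mono hle).aestronglyMeasurable one_le_two
      _ ≤ eLpNorm h 2 Q + eLpNorm h 2 Q := by
          gcongr
          exact eLpNorm_condExp_le_eLpNorm h one_le_two
      _ = 2 * eLpNorm h 2 Q := (two_mul _).symm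
  calc mmse Q u v = eLpNorm (fun s => u s - (Q[u | mF.comap v]) s) 2 Q ^ 2 :=
        hsq fun s => u s - (Q[u | mF.comap v]) s
    _ ≤ (2 * eLpNorm h 2 Q) ^ 2 := by gcongr
    _ = 4 * ∫⁻ s, ‖h s‖ₑ ^ 2 ∂Q := by rw [hsq, mul_pow]; norm_num

/-- A measure-preserving transformation `r` of the seed that leaves the observation unchanged
forces the mean-squared error to be at least a quarter of the mean-squared displacement of the
signal under `r`. -/
lemma lintegral_displacement_le_four_mul_mmse {R : Type*} [MeasurableSpace R] {Γ : Measure R}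
    {f : R → S} (hf : Measurable f) {r : R → R} (hr : MeasurePreserving r Γ Γ)
    {u : S → E} (hu : StronglyMeasurable u) {v : S → F} (hv : Measurable v)
    (hinv : ∀ s, v (f (r s)) = v (f s)) :
    ∫⁻ s, ‖u (f s) - u (f (r s))‖ₑ ^ 2 ∂Γ ≤ 4 * mmse (Γ.map f) u v := by
  have hle : mF.comap v ≤ mS := hv.comap_le
  set e : S → E := (Γ.map f)[u | mF.comap v] with he
  have hem : StronglyMeasurable[mF.comap v] e := stronglyMeasurable_condExp
  -- The conditional mean is a function of the observation, so it cannot distinguish `f s` from `f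
  -- (r s)`.
  have hefac : ∀ s, e (f (r s)) = e (f s) := fun s => hem.factorsThrough (hinv s)
  set G : S → ℝ≥0∞ := fun s => ‖u s - e s‖ₑ ^ 2 with hG
  have hGm : Measurable G := ((hu.sub (hem.mono hle)).enorm).pow_const 2
  have hmm : mmse (Γ.map f) u v = ∫⁻ s, G (f s) ∂Γ := lintegral_map hGm hf
  have hmr : mmse (Γ.map f) u v = ∫⁻ s, G (f (r s)) ∂Γ := by
    rw [hmm]
    exact (hr.lintegral_comp (hGm.comp hf)).symm
  have hpt : ∀ s, ‖u (f s) - u (f (r s))‖ₑ ^ 2 ≤ 2 * (G (f s) + G (f (r s))) := by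
    intro s
    have h1 : u (f s) - u (f (r s)) = (u (f s) - e (f s)) - (u (f (r s)) - e (f (r s))) := by
      rw [hefac]; abel
    rw [h1]
    calc ‖(u (f s) - e (f s)) - (u (f (r s)) - e (f (r s)))‖ₑ ^ 2
        ≤ (‖u (f s) - e (f s)‖ₑ + ‖u (f (r s)) - e (f (r s))‖ₑ) ^ 2 := by
          gcongr; exact enorm_sub_le
      _ ≤ 2 * (G (f s) + G (f (r s))) := by
          have := ENNReal.rpow_add_le_mul_rpow_add_rpow ‖u (f s) - e (f s)‖ₑ
            ‖u (f (r s)) - e (f (r s))‖ₑ (p := 2) one_le_two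
          norm_num at this
          exact this
  calc ∫⁻ s, ‖u (f s) - u (f (r s))‖ₑ ^ 2 ∂Γ ≤ ∫⁻ s, 2 * (G (f s) + G (f (r s))) ∂Γ :=
        lintegral_mono hpt
    _ = 2 * (mmse (Γ.map f) u v + mmse (Γ.map f) u v) := by
        have hadd : ∫⁻ s, G (f s) + G (f (r s)) ∂Γ = ∫⁻ s, G (f s) ∂Γ + ∫⁻ s, G (f (r s)) ∂Γ :=
          lintegral_add_left (hGm.comp hf) _
        rw [lintegral_const_mul' _ _ (by simp), hadd, ← hmm, ← hmr]
    _ = 4 * mmse (Γ.map f) u v := by rw [← two_mul, ← mul_assoc]; norm_num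

end Mmse

/-! ### Gaussian seeds, exact linear recovery and invisible directions -/

section Seed

variable {n₁ n₂ m₁ m₂ : ℕ}

/-- The law of a standard Gaussian seed of the source and noise vectors. -/
def seedLaw (n₁ n₂ m₁ m₂ : ℕ) : Measure (Sample n₁ n₂ m₁ m₂) :=
  (stdGaussian (EuclideanSpace ℝ (Fin n₁ ⊕ Fin n₂))).prod
    ((stdGaussian (EuclideanSpace ℝ (Fin m₁))).prod (stdGaussian (EuclideanSpace ℝ (Fin m₂))))

/-- The source and noise vectors as a function of the standard Gaussian seed. -/
def synthesize (μ : EuclideanSpace ℝ (Fin n₁ ⊕ Fin n₂))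
    (L : Matrix (Fin n₁ ⊕ Fin n₂) (Fin n₁ ⊕ Fin n₂) ℝ) (v : ℝ) (s : Sample n₁ n₂ m₁ m₂) :
    Sample n₁ n₂ m₁ m₂ :=
  (μ + Matrix.toEuclideanCLM (𝕜 := ℝ) L s.1, (√v • s.2.1, √v • s.2.2))

instance : IsGaussian (seedLaw n₁ n₂ m₁ m₂) := by
  unfold seedLaw; infer_instance

instance (μ : EuclideanSpace ℝ (Fin n₁ ⊕ Fin n₂))
    (C : Matrix (Fin n₁ ⊕ Fin n₂) (Fin n₁ ⊕ Fin n₂) ℝ) (v : ℝ) :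
    IsGaussian (sampleLaw m₁ m₂ μ C v) := by
  unfold sampleLaw; infer_instance

lemma measurable_synthesize (μ : EuclideanSpace ℝ (Fin n₁ ⊕ Fin n₂))
    (L : Matrix (Fin n₁ ⊕ Fin n₂) (Fin n₁ ⊕ Fin n₂) ℝ) (v : ℝ) :
    Measurable (synthesize μ L v : Sample n₁ n₂ m₁ m₂ → Sample n₁ n₂ m₁ m₂) := by
  unfold synthesize; fun_prop

/-- Comparing characteristic functions avoids computing the matrix square root of `v • 1`. -/
lemma multivariateGaussian_zero_smul_one {ι : Type*} [Fintype ι] [DecidableEq ι] {v : ℝ}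
    (hv : 0 ≤ v) : multivariateGaussian 0 (v • (1 : Matrix ι ι ℝ)) =
      (stdGaussian (EuclideanSpace ℝ ι)).map (fun w => √v • w) := by
  have hps : (v • (1 : Matrix ι ι ℝ)).PosSemidef := Matrix.PosSemidef.one.smul hv
  have : IsProbabilityMeasure ((stdGaussian (EuclideanSpace ℝ ι)).map (fun w => √v • w)) :=
    Measure.isProbabilityMeasure_map (by fun_prop)
  apply Measure.ext_of_charFun
  ext t
  rw [charFun_multivariateGaussian hps, charFun_map_smul, charFun_stdGaussian, norm_smul,
    ← Complex.ofReal_pow, mul_pow, Real.norm_eq_abs, sq_abs, Real.sq_sqrt hv,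
    EuclideanSpace.real_norm_sq_eq]
  simp [Matrix.smul_mulVec, dotProduct, pow_two, neg_div, Finset.mul_sum, mul_left_comm]

/-- All noise levels now live on one probability space, and `v` enters only through the factor `√v`
on the noise. -/
lemma sampleLaw_eq_map_seedLaw (μ : EuclideanSpace ℝ (Fin n₁ ⊕ Fin n₂))
    (C : Matrix (Fin n₁ ⊕ Fin n₂) (Fin n₁ ⊕ Fin n₂) ℝ) {v : ℝ} (hv : 0 ≤ v) :
    sampleLaw m₁ m₂ μ C v = (seedLaw n₁ n₂ m₁ m₂).map (synthesize μ (CFC.sqrt C) v) := by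
  rw [sampleLaw, multivariateGaussian_zero_smul_one hv, multivariateGaussian_zero_smul_one hv,
    Measure.map_prod_map _ _ (by fun_prop) (by fun_prop), multivariateGaussian,
    Measure.map_prod_map _ _ (by fun_prop) (by fun_prop)]
  rfl

/-- The signal of interest as a continuous linear map. -/
def signalL : Sample n₁ n₂ m₁ m₂ →L[ℝ] EuclideanSpace ℝ (Fin n₁) :=
  LinearMap.toContinuousLinearMap
    { toFun := signal
      map_add' := fun _ _ => rfl
      map_smul' := fun _ _ => rfl }

/-- The side information signal as a continuous linear map. -/
def sideL : Sample n₁ n₂ m₁ m₂ →L[ℝ] EuclideanSpace ℝ (Fin n₂) :=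
  LinearMap.toContinuousLinearMap
    { toFun := side
      map_add' := fun _ _ => rfl
      map_smul' := fun _ _ => rfl }

lemma continuous_signal : Continuous (signal : Sample n₁ n₂ m₁ m₂ → _) :=
  (signalL (n₁ := n₁) (n₂ := n₂) (m₁ := m₁) (m₂ := m₂)).continuous

/-- The noisy features as a continuous linear map. -/
def featuresL (A₁ : Matrix (Fin m₁) (Fin n₁) ℝ) (A₂ : Matrix (Fin m₂) (Fin n₂) ℝ) :
    Sample n₁ n₂ m₁ m₂ →L[ℝ] EuclideanSpace ℝ (Fin m₁) × EuclideanSpace ℝ (Fin m₂) :=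
  ((LinearMap.toContinuousLinearMap A₁.toEuclideanLin ∘L signalL +
      ContinuousLinearMap.fst ℝ _ _ ∘L ContinuousLinearMap.snd ℝ _ _).prod
    (LinearMap.toContinuousLinearMap A₂.toEuclideanLin ∘L sideL +
      ContinuousLinearMap.snd ℝ _ _ ∘L ContinuousLinearMap.snd ℝ _ _))

lemma coe_featuresL (A₁ : Matrix (Fin m₁) (Fin n₁) ℝ) (A₂ : Matrix (Fin m₂) (Fin n₂) ℝ) :
    (featuresL A₁ A₂ : Sample n₁ n₂ m₁ m₂ → _) = features A₁ A₂ := rfl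

lemma continuous_features (A₁ : Matrix (Fin m₁) (Fin n₁) ℝ) (A₂ : Matrix (Fin m₂) (Fin n₂) ℝ) :
    Continuous (features A₁ A₂ : Sample n₁ n₂ m₁ m₂ → _) :=
  (featuresL A₁ A₂).continuous

/-- The linear estimator with gain matrices `G₁` and `G₂`. -/
def linearEstimator (G₁ : Matrix (Fin n₁) (Fin m₁) ℝ) (G₂ : Matrix (Fin n₁) (Fin m₂) ℝ) :
    EuclideanSpace ℝ (Fin m₁) × EuclideanSpace ℝ (Fin m₂) →L[ℝ] EuclideanSpace ℝ (Fin n₁) :=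
  (LinearMap.toContinuousLinearMap G₁.toEuclideanLin).coprod
    (LinearMap.toContinuousLinearMap G₂.toEuclideanLin)

/-- The offset that makes the linear estimator unbiased. -/
def estimatorOffset (A₁ : Matrix (Fin m₁) (Fin n₁) ℝ) (A₂ : Matrix (Fin m₂) (Fin n₂) ℝ)
    (μ : EuclideanSpace ℝ (Fin n₁ ⊕ Fin n₂))
    (G₁ : Matrix (Fin n₁) (Fin m₁) ℝ) (G₂ : Matrix (Fin n₁) (Fin m₂) ℝ) :
    EuclideanSpace ℝ (Fin n₁) :=
  signal ((μ, (0, 0)) : Sample n₁ n₂ m₁ m₂) -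
    linearEstimator G₁ G₂ (features A₁ A₂ (μ, (0, 0)))

/-- The error of an estimator that is exact on noiseless features is the filtered noise. -/
lemma signal_sub_linearEstimator {A₁ : Matrix (Fin m₁) (Fin n₁) ℝ}
    {A₂ : Matrix (Fin m₂) (Fin n₂) ℝ} (μ : EuclideanSpace ℝ (Fin n₁ ⊕ Fin n₂))
    (L : Matrix (Fin n₁ ⊕ Fin n₂) (Fin n₁ ⊕ Fin n₂) ℝ)
    {G₁ : Matrix (Fin n₁) (Fin m₁) ℝ} {G₂ : Matrix (Fin n₁) (Fin m₂) ℝ}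
    (hG : L.toRows₁ = G₁ * A₁ * L.toRows₁ + G₂ * A₂ * L.toRows₂)
    (v : ℝ) (s : Sample n₁ n₂ m₁ m₂) :
    signal (synthesize μ L v s) - (estimatorOffset A₁ A₂ μ G₁ G₂ +
      linearEstimator G₁ G₂ (features A₁ A₂ (synthesize μ L v s))) =
        -(√v • linearEstimator G₁ G₂ s.2) := by
  -- Mean, source fluctuation and noise: the offset cancels the first, `hG` the second, and the
  -- signal has no part in the third.
  have hsplit : synthesize μ L v s = (μ, (0, 0)) +
      ((Matrix.toEuclideanCLM (𝕜 := ℝ) L s.1, (0, 0)) + √v • ((0, s.2) :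
        Sample n₁ n₂ m₁ m₂)) := by
    ext <;> simp [synthesize]
  have hlin : signal ((Matrix.toEuclideanCLM (𝕜 := ℝ) L s.1, (0, 0)) :
        Sample n₁ n₂ m₁ m₂) =
      linearEstimator G₁ G₂ (features A₁ A₂ (Matrix.toEuclideanCLM (𝕜 := ℝ) L s.1, (0, 0))) := by
    have hf : features A₁ A₂ ((Matrix.toEuclideanCLM (𝕜 := ℝ) L s.1, (0, 0)) :
        Sample n₁ n₂ m₁ m₂) =
        (WithLp.toLp 2 (A₁.mulVec (L.toRows₁.mulVec s.1.ofLp)),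
          WithLp.toLp 2 (A₂.mulVec (L.toRows₂.mulVec s.1.ofLp))) := by
      ext i
      · exact add_zero _
      · exact add_zero _
    have h1 := congrArg (fun M : Matrix (Fin n₁) (Fin n₁ ⊕ Fin n₂) ℝ =>
      Matrix.mulVec M s.1.ofLp) hG
    simp only [Matrix.add_mulVec, ← Matrix.mulVec_mulVec] at h1
    rw [hf]
    ext i
    exact congrFun h1 i
  have hnoise : features A₁ A₂ ((0, s.2) : Sample n₁ n₂ m₁ m₂) = s.2 := by
    have h1 : signal ((0, s.2) : Sample n₁ n₂ m₁ m₂) = 0 := rfl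
    have h2 : side ((0, s.2) : Sample n₁ n₂ m₁ m₂) = 0 := rfl
    simp [features, h1, h2]
  have hs0 : signal ((0, s.2) : Sample n₁ n₂ m₁ m₂) = 0 := rfl
  rw [hsplit]
  change signalL _ - (signal _ - linearEstimator G₁ G₂ (features A₁ A₂ _) + linearEstimator G₁ G₂ (featuresL A₁ A₂ _)) = _
  simp only [map_add, map_smul]
  change signal _ + (signal _ + √v • signal _) - (signal _ - linearEstimator G₁ G₂ (features A₁ A₂ _) + (linearEstimator G₁ G₂ (features A₁ A₂ _) +
    (linearEstimator G₁ G₂ (features A₁ A₂ _) + √v • linearEstimator G₁ G₂ (features A₁ A₂ _)))) = _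
  rw [hnoise, hs0, hlin, smul_zero]
  abel

/-- If the signal is, up to an additive constant, a linear function of the noiseless features, then
the minimum mean-squared error vanishes as the noise does. -/
lemma tendsto_mmseSide {A₁ : Matrix (Fin m₁) (Fin n₁) ℝ} {A₂ : Matrix (Fin m₂) (Fin n₂) ℝ}
    (μ : EuclideanSpace ℝ (Fin n₁ ⊕ Fin n₂))
    (C : Matrix (Fin n₁ ⊕ Fin n₂) (Fin n₁ ⊕ Fin n₂) ℝ)
    {G₁ : Matrix (Fin n₁) (Fin m₁) ℝ} {G₂ : Matrix (Fin n₁) (Fin m₂) ℝ}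
    (hG : (CFC.sqrt C).toRows₁ =
      G₁ * A₁ * (CFC.sqrt C).toRows₁ + G₂ * A₂ * (CFC.sqrt C).toRows₂) :
    Tendsto (fun v : ℝ => mmseSide A₁ A₂ μ C v) (𝓝[>] 0) (𝓝 0) := by
  set Λ := linearEstimator G₁ G₂
  set c := estimatorOffset A₁ A₂ μ G₁ G₂
  let g : EuclideanSpace ℝ (Fin m₁) × EuclideanSpace ℝ (Fin m₂) → EuclideanSpace ℝ (Fin n₁) :=
    fun y => c + Λ y
  have herr : ∀ (v : ℝ) (s : Sample n₁ n₂ m₁ m₂),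
      signal (synthesize μ (CFC.sqrt C) v s) - g (features A₁ A₂ (synthesize μ (CFC.sqrt C) v s)) =
        -(√v • Λ s.2) := signal_sub_linearEstimator μ _ hG
  have hk : MemLp (fun s : Sample n₁ n₂ m₁ m₂ => Λ s.2) 2 (seedLaw n₁ n₂ m₁ m₂) :=
    (Λ ∘L ContinuousLinearMap.snd ℝ (EuclideanSpace ℝ (Fin n₁ ⊕ Fin n₂))
      (EuclideanSpace ℝ (Fin m₁) × EuclideanSpace ℝ (Fin m₂))).comp_memLp'
        (IsGaussian.memLp_two_id (μ := seedLaw n₁ n₂ m₁ m₂))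
  set K : ℝ≥0∞ := ∫⁻ s, ‖Λ s.2‖ₑ ^ 2 ∂(seedLaw n₁ n₂ m₁ m₂) with hK
  have hKfin : K ≠ ∞ := by
    have := eLpNorm_nnreal_pow_eq_lintegral (μ := seedLaw n₁ n₂ m₁ m₂)
      (f := fun s => Λ s.2) (p := 2) two_ne_zero
    have h2 : K = eLpNorm (fun s : Sample n₁ n₂ m₁ m₂ => Λ s.2) 2 (seedLaw n₁ n₂ m₁ m₂) ^ 2 := by
      simpa using this.symm
    rw [h2]
    exact ENNReal.pow_ne_top hk.2.ne
  have hbound : ∀ v : ℝ, 0 < v → mmseSide A₁ A₂ μ C v ≤ 4 * (ENNReal.ofReal v * K) := by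
    intro v hv
    have hcont : Continuous fun s : Sample n₁ n₂ m₁ m₂ => signal s - g (features A₁ A₂ s) :=
      continuous_signal.sub (continuous_const.add (Λ.continuous.comp (continuous_features A₁ A₂)))
    have hmap := sampleLaw_eq_map_seedLaw (m₁ := m₁) (m₂ := m₂) μ C hv.le
    have hint : Integrable (g ∘ features A₁ A₂) (sampleLaw m₁ m₂ μ C v) :=
      (integrable_const c).add
        (((Λ ∘L featuresL A₁ A₂).comp_memLp' IsGaussian.memLp_two_id).integrable one_le_two)
    have hmem : MemLp (fun s => signal s - g (features A₁ A₂ s)) 2 (sampleLaw m₁ m₂ μ C v) := by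
      rw [hmap, memLp_map_measure_iff hcont.aestronglyMeasurable
        (measurable_synthesize _ _ _).aemeasurable]
      have : (fun s => signal s - g (features A₁ A₂ s)) ∘ synthesize μ (CFC.sqrt C) v =
          fun s => -(√v • Λ s.2) := funext (herr v)
      rw [this]
      exact (hk.const_smul (√v)).neg
    refine (mmse_le_four_mul (g := g) (continuous_features A₁ A₂).measurable
      (continuous_const.add Λ.continuous).stronglyMeasurable hint hmem).trans_eq ?_
    rw [hmap, lintegral_map (hcont.measurable.enorm.pow_const 2) (measurable_synthesize _ _ _)]
    congr 1
    rw [hK, ← lintegral_const_mul' _ _ ENNReal.ofReal_ne_top]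
    refine lintegral_congr fun s => ?_
    rw [herr, enorm_neg, enorm_smul, mul_pow, Real.enorm_of_nonneg (Real.sqrt_nonneg _),
      ← ENNReal.ofReal_pow (Real.sqrt_nonneg _), Real.sq_sqrt hv.le]
  have hlim : Tendsto (fun v : ℝ => 4 * (ENNReal.ofReal v * K)) (𝓝[>] 0) (𝓝 0) := by
    have h1 : Tendsto ENNReal.ofReal (𝓝[>] 0) (𝓝 0) := by
      have := (ENNReal.continuous_ofReal.tendsto 0).mono_left (nhdsWithin_le_nhds (s := Set.Ioi 0))
      simpa using this
    have h2 := ENNReal.Tendsto.const_mul (a := 4)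
      (ENNReal.Tendsto.mul_const (b := K) h1 (Or.inr hKfin)) (Or.inr (by simp))
    simpa using h2
  refine tendsto_of_tendsto_of_tendsto_of_le_of_le' tendsto_const_nhds hlim
    (Eventually.of_forall fun _ => zero_le) ?_
  filter_upwards [self_mem_nhdsWithin] with v hv using hbound v hv

/-- A direction of the source that is invisible in the noiseless features but not in the signal keeps
the minimum mean-squared error away from zero. -/
lemma exists_pos_le_mmseSide {A₁ : Matrix (Fin m₁) (Fin n₁) ℝ} {A₂ : Matrix (Fin m₂) (Fin n₂) ℝ}
    (μ : EuclideanSpace ℝ (Fin n₁ ⊕ Fin n₂))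
    (C : Matrix (Fin n₁ ⊕ Fin n₂) (Fin n₁ ⊕ Fin n₂) ℝ)
    {t : Fin n₁ ⊕ Fin n₂ → ℝ} (h₁ : A₁.mulVec ((CFC.sqrt C).toRows₁.mulVec t) = 0)
    (h₂ : A₂.mulVec ((CFC.sqrt C).toRows₂.mulVec t) = 0)
    (h₀ : (CFC.sqrt C).toRows₁.mulVec t ≠ 0) :
    ∃ c : ℝ≥0∞, 0 < c ∧ ∀ v : ℝ, 0 < v → c ≤ 4 * mmseSide A₁ A₂ μ C v := by
  set τ : EuclideanSpace ℝ (Fin n₁ ⊕ Fin n₂) := WithLp.toLp 2 t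
  set z : EuclideanSpace ℝ (Fin n₁) := WithLp.toLp 2 ((CFC.sqrt C).toRows₁.mulVec t)
  have hz0 : z ≠ 0 := fun h => h₀ (congrArg WithLp.ofLp h)
  have hτ0 : τ ≠ 0 := by
    intro h
    have : t = 0 := congrArg WithLp.ofLp h
    exact h₀ (by rw [this, Matrix.mulVec_zero])
  -- `reflection` fixes the line through `τ` and negates its complement, so its negative flips only
  -- the `τ`-component. As a linear isometry it preserves the standard Gaussian.
  let ρ := (Submodule.span ℝ {τ}).reflection.trans (LinearIsometryEquiv.neg ℝ)
  let a : EuclideanSpace ℝ (Fin n₁ ⊕ Fin n₂) → ℝ := fun x => 2 * (inner ℝ τ x / ‖τ‖ ^ 2)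
  have hρ : ∀ x, ρ x = x - a x • τ := by
    intro x
    change -((Submodule.span ℝ {τ}).reflection x) = _
    rw [Submodule.reflection_singleton_apply]
    simp only [a, mul_smul, two_smul, RCLike.ofReal_real_eq_id, id_eq]
    abel
  let r : Sample n₁ n₂ m₁ m₂ → Sample n₁ n₂ m₁ m₂ := Prod.map ρ id
  have hr : MeasurePreserving r (seedLaw n₁ n₂ m₁ m₂) (seedLaw n₁ n₂ m₁ m₂) := by
    have h1 : MeasurePreserving ρ (stdGaussian (EuclideanSpace ℝ (Fin n₁ ⊕ Fin n₂)))
        (stdGaussian (EuclideanSpace ℝ (Fin n₁ ⊕ Fin n₂))) :=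
      ⟨ρ.continuous.measurable, stdGaussian_map ρ⟩
    exact h1.prod (MeasurePreserving.id _)
  have hdiff : ∀ (v : ℝ) (s : Sample n₁ n₂ m₁ m₂), synthesize μ (CFC.sqrt C) v (r s) =
      synthesize μ (CFC.sqrt C) v s -
        a s.1 • (Matrix.toEuclideanCLM (𝕜 := ℝ) (CFC.sqrt C) τ, ((0, 0) : _ × _)) := by
    intro v s
    have : r s = (s.1 - a s.1 • τ, s.2) := Prod.ext (hρ s.1) rfl
    rw [this]
    ext <;> simp [synthesize]
    ring
  have hfeat : features A₁ A₂ (Matrix.toEuclideanCLM (𝕜 := ℝ) (CFC.sqrt C) τ, ((0, 0) :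
      EuclideanSpace ℝ (Fin m₁) × EuclideanSpace ℝ (Fin m₂))) = 0 := by
    ext i
    · exact (add_zero _).trans (congrFun h₁ i)
    · exact (add_zero _).trans (congrFun h₂ i)
  have hinv : ∀ (v : ℝ) (s : Sample n₁ n₂ m₁ m₂),
      features A₁ A₂ (synthesize μ (CFC.sqrt C) v (r s)) =
        features A₁ A₂ (synthesize μ (CFC.sqrt C) v s) := by
    intro v s
    rw [hdiff, ← coe_featuresL, map_sub, map_smul, coe_featuresL, hfeat, smul_zero, sub_zero]
  have hdisp : ∀ (v : ℝ) (s : Sample n₁ n₂ m₁ m₂), signal (synthesize μ (CFC.sqrt C) v s) -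
      signal (synthesize μ (CFC.sqrt C) v (r s)) = a s.1 • z := by
    intro v s
    rw [hdiff]
    change signalL _ - signalL (_ - _) = _
    rw [map_sub, map_smul, sub_sub_cancel]
    rfl
  have ham : Measurable a := by fun_prop
  refine ⟨∫⁻ s, ‖a s.1 • z‖ₑ ^ 2 ∂(seedLaw n₁ n₂ m₁ m₂), ?_, ?_⟩
  · rw [pos_iff_ne_zero]
    intro h
    have hzero : ∀ᵐ x ∂(stdGaussian (EuclideanSpace ℝ (Fin n₁ ⊕ Fin n₂))), inner ℝ τ x = (0 : ℝ) := by
      have hm : Measurable fun x : EuclideanSpace ℝ (Fin n₁ ⊕ Fin n₂) => ‖a x • z‖ₑ ^ 2 := by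
        fun_prop
      have hfst : MeasurePreserving Prod.fst (seedLaw n₁ n₂ m₁ m₂)
          (stdGaussian (EuclideanSpace ℝ (Fin n₁ ⊕ Fin n₂))) := measurePreserving_fst
      have h' : ∫⁻ x, ‖a x • z‖ₑ ^ 2 ∂(stdGaussian (EuclideanSpace ℝ (Fin n₁ ⊕ Fin n₂))) = 0 := by
        rw [← hfst.lintegral_comp hm]; exact h
      rw [lintegral_eq_zero_iff hm] at h'
      filter_upwards [h'] with x hx
      have h3 : a x • z = 0 := by simpa using hx
      have h4 : a x = 0 := (smul_eq_zero.1 h3).resolve_right hz0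
      have h5 : ‖τ‖ ^ 2 ≠ 0 := by positivity
      simpa [a, h5, hτ0] using h4
    have hvar := variance_dual_stdGaussian (innerSL ℝ τ)
    -- A vanishing displacement would make `⟨τ, x⟩` almost surely zero, yet its variance is `‖τ‖ ^
    -- 2`.
    have : Var[innerSL ℝ τ; stdGaussian (EuclideanSpace ℝ (Fin n₁ ⊕ Fin n₂))] = 0 := by
      refine (variance_congr (X := innerSL ℝ τ) (Y := 0) hzero).trans ?_
      exact variance_zero _
    rw [this, innerSL_apply_norm] at hvar
    exact hτ0 (by simpa using hvar.symm)
  · intro v hv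
    have key := lintegral_displacement_le_four_mul_mmse (Γ := seedLaw n₁ n₂ m₁ m₂)
      (measurable_synthesize μ (CFC.sqrt C) v) hr continuous_signal.stronglyMeasurable
      (continuous_features A₁ A₂).measurable (hinv v)
    rw [mmseSide, sampleLaw_eq_map_seedLaw μ C hv.le]
    refine le_trans (le_of_eq ?_) key
    exact lintegral_congr fun s => by rw [hdisp]

end Seed


/-! ### Row-space criterion for fixed kernels -/

section RowSpace

open Module Matrix
open scoped MatrixOrder

variable {n₁ n₂ m₁ m₂ : ℕ}

lemma finrank_range_vecMulLinear {m n : Type*} [Fintype m] [Fintype n]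
    (M : Matrix m n ℝ) : finrank ℝ (LinearMap.range M.vecMulLinear) = M.rank := by
  rw [_root_.range_vecMulLinear, Matrix.rank_eq_finrank_span_row]

lemma range_vecMulLinear_toRows_sup {n : Type*} (M : Matrix (Fin n₁ ⊕ Fin n₂) n ℝ) :
    LinearMap.range M.toRows₁.vecMulLinear ⊔ LinearMap.range M.toRows₂.vecMulLinear =
      LinearMap.range M.vecMulLinear := by
  rw [_root_.range_vecMulLinear, _root_.range_vecMulLinear, _root_.range_vecMulLinear, ← Submodule.span_union]
  congr 1
  ext x
  simp only [Set.mem_union, Set.mem_range, Sum.exists]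
  rfl

variable {C : Matrix (Fin n₁ ⊕ Fin n₂) (Fin n₁ ⊕ Fin n₂) ℝ}

/-- The diagonal blocks of this identity are the Gram matrices of the row blocks, and a real matrix
has the rank of its Gram matrix; the next three rank formulas follow. -/
lemma sqrt_mul_transpose_sqrt (hC : C.PosSemidef) : CFC.sqrt C * (CFC.sqrt C).transpose = C := by
  have hsa : (CFC.sqrt C).conjTranspose = CFC.sqrt C := (CFC.sqrt_nonneg C).isSelfAdjoint
  rw [Matrix.conjTranspose_eq_transpose_of_trivial] at hsa
  rw [hsa]
  exact CFC.sqrt_mul_sqrt_self C hC.nonneg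

lemma rank_sqrt (hC : C.PosSemidef) : (CFC.sqrt C).rank = C.rank := by
  rw [← Matrix.rank_self_mul_transpose, sqrt_mul_transpose_sqrt hC]

lemma rank_toRows₁_sqrt (hC : C.PosSemidef) :
    (CFC.sqrt C).toRows₁.rank = C.toBlocks₁₁.rank := by
  rw [← Matrix.rank_self_mul_transpose]
  congr 1
  exact congrArg Matrix.toBlocks₁₁ (sqrt_mul_transpose_sqrt hC)

lemma rank_toRows₂_sqrt (hC : C.PosSemidef) :
    (CFC.sqrt C).toRows₂.rank = C.toBlocks₂₂.rank := by
  rw [← Matrix.rank_self_mul_transpose]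
  congr 1
  exact congrArg Matrix.toBlocks₂₂ (sqrt_mul_transpose_sqrt hC)

/-- The minimum mean-squared error vanishes with the noise exactly when the rows that generate the
signal lie in the row space of the noiseless features. -/
lemma tendsto_mmseSide_iff (A₁ : Matrix (Fin m₁) (Fin n₁) ℝ) (A₂ : Matrix (Fin m₂) (Fin n₂) ℝ)
    (μ : EuclideanSpace ℝ (Fin n₁ ⊕ Fin n₂))
    (C : Matrix (Fin n₁ ⊕ Fin n₂) (Fin n₁ ⊕ Fin n₂) ℝ) :
    Tendsto (fun v : ℝ => mmseSide A₁ A₂ μ C v) (𝓝[>] 0) (𝓝 0) ↔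
      LinearMap.range (CFC.sqrt C).toRows₁.vecMulLinear ≤
        Submodule.span ℝ (Set.range fun i => (CFC.sqrt C).toRows₁.vecMulLinear (A₁ i)) ⊔
          Submodule.span ℝ (Set.range fun i => (CFC.sqrt C).toRows₂.vecMulLinear (A₂ i)) := by
  set L₁ := (CFC.sqrt C).toRows₁ with hL₁
  set L₂ := (CFC.sqrt C).toRows₂ with hL₂
  constructor
  · intro hlim
    by_contra hnot
    obtain ⟨_, ⟨a, rfl⟩, ha⟩ := Set.not_subset.1 hnot
    -- A functional separating the missing vector from the feature row space is the dot product with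
    -- some `t`, the invisible direction.
    obtain ⟨f, hfa, hf⟩ := Submodule.exists_le_ker_of_notMem ha
    obtain ⟨t, ht⟩ : ∃ t : Fin n₁ ⊕ Fin n₂ → ℝ, ∀ x, f x = x ⬝ᵥ t := by
      refine ⟨fun i => f (Pi.single i 1), fun x => ?_⟩
      rw [LinearMap.pi_apply_eq_sum_univ f x]
      refine Finset.sum_congr rfl fun i _ => ?_
      rw [smul_eq_mul]
      congr 2
      ext j
      simp [Pi.single_apply, eq_comm]
    have hker₁ : ∀ i, f (L₁.vecMulLinear (A₁ i)) = 0 := fun i => hf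
      (Submodule.mem_sup_left (Submodule.subset_span ⟨i, rfl⟩))
    have hker₂ : ∀ i, f (L₂.vecMulLinear (A₂ i)) = 0 := fun i => hf
      (Submodule.mem_sup_right (Submodule.subset_span ⟨i, rfl⟩))
    have h₁ : A₁.mulVec (L₁.mulVec t) = 0 := by
      ext i
      have := hker₁ i
      rw [ht, Matrix.vecMulLinear_apply, ← Matrix.dotProduct_mulVec] at this
      exact this
    have h₂ : A₂.mulVec (L₂.mulVec t) = 0 := by
      ext i
      have := hker₂ i
      rw [ht, Matrix.vecMulLinear_apply, ← Matrix.dotProduct_mulVec] at this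
      exact this
    have h₀ : L₁.mulVec t ≠ 0 := by
      intro h
      apply hfa
      rw [ht, Matrix.vecMulLinear_apply, ← Matrix.dotProduct_mulVec, h, dotProduct_zero]
    obtain ⟨c, hc, hle⟩ := exists_pos_le_mmseSide μ C h₁ h₂ h₀
    have hlim4 := ENNReal.Tendsto.const_mul (a := 4) hlim (Or.inr (by simp))
    rw [mul_zero] at hlim4
    refine hc.not_ge (ge_of_tendsto hlim4 ?_)
    filter_upwards [self_mem_nhdsWithin] with v hv using hle v hv
  · intro hle
    -- The coefficients expressing row `i` of `L₁` become row `i` of the gain matrices.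
    have hrow : ∀ i : Fin n₁, ∃ (c₁ : Fin m₁ → ℝ) (c₂ : Fin m₂ → ℝ),
        L₁ i = Matrix.vecMul (Matrix.vecMul c₁ A₁) L₁ + Matrix.vecMul (Matrix.vecMul c₂ A₂) L₂ := by
      intro i
      have hmem : L₁ i ∈ LinearMap.range L₁.vecMulLinear :=
        ⟨Pi.single i 1, by rw [Matrix.vecMulLinear_apply, Matrix.single_one_vecMul]; rfl⟩
      obtain ⟨x, hx, y, hy, hxy⟩ := Submodule.mem_sup.1 (hle hmem)
      obtain ⟨c₁, rfl⟩ := (Submodule.mem_span_range_iff_exists_fun ℝ).1 hx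
      obtain ⟨c₂, rfl⟩ := (Submodule.mem_span_range_iff_exists_fun ℝ).1 hy
      refine ⟨c₁, c₂, ?_⟩
      rw [← hxy, Matrix.vecMul_eq_sum c₁, Matrix.vecMul_eq_sum c₂, ← Matrix.vecMulLinear_apply,
        ← Matrix.vecMulLinear_apply, map_sum, map_sum]
      simp only [map_smul]
    choose G₁ G₂ hG using hrow
    refine tendsto_mmseSide (G₁ := Matrix.of G₁) (G₂ := Matrix.of G₂) μ C ?_
    ext i j
    exact congrFun (hG i) j

end RowSpace

/-! ### From generic kernels to random kernels -/

open scoped MatrixOrder in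
/-- For generic measurement matrices, the minimum mean-squared error vanishes with the noise exactly
when the rank condition holds. -/
lemma ae_tendsto_mmseSide_iff {n₁ n₂ m₁ m₂ : ℕ} (μ : EuclideanSpace ℝ (Fin n₁ ⊕ Fin n₂))
    {C : Matrix (Fin n₁ ⊕ Fin n₂) (Fin n₁ ⊕ Fin n₂) ℝ} (hC : C.PosSemidef) :
    ∀ᵐ A : (Fin m₁ → Fin n₁ → ℝ) × (Fin m₂ → Fin n₂ → ℝ),
      Tendsto (fun v : ℝ => mmseSide (Matrix.of A.1) (Matrix.of A.2) μ C v) (𝓝[>] 0) (𝓝 0) ↔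
        (C.toBlocks₁₁.rank ≤ m₁ ∨
          (C.rank - C.toBlocks₂₂.rank ≤ m₁ ∧ C.rank ≤ m₁ + m₂)) := by
  filter_upwards [ae_range_le_sup_span_iff (m₁ := m₁) (m₂ := m₂)
    (CFC.sqrt C).toRows₁.vecMulLinear (CFC.sqrt C).toRows₂.vecMulLinear] with A hA
  rw [tendsto_mmseSide_iff]
  refine Iff.trans hA ?_
  rw [range_vecMulLinear_toRows_sup, finrank_range_vecMulLinear, finrank_range_vecMulLinear,
    finrank_range_vecMulLinear, rank_sqrt hC, rank_toRows₁_sqrt hC, rank_toRows₂_sqrt hC]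

lemma map_entries_absolutelyContinuous {Ω : Type*} [MeasurableSpace Ω] {P : Measure Ω} {m n : ℕ}
    {Φ : Ω → Matrix (Fin m) (Fin n) ℝ} (h : IsLeftRotationInvariant P Φ) :
    P.map (entries Φ) ≪ volume := by
  obtain ⟨p, _, hp, _⟩ := h
  rw [hp]
  exact withDensity_absolutelyContinuous _ _

end SideInformation

end

theorem theorem3 {n₁ n₂ m₁ m₂ : ℕ}
    {Ω : Type*} [MeasurableSpace Ω] (P : MeasureTheory.Measure Ω)
    [MeasureTheory.IsProbabilityMeasure P]
    (Φ₁ : Ω → Matrix (Fin m₁) (Fin n₁) ℝ) (Φ₂ : Ω → Matrix (Fin m₂) (Fin n₂) ℝ)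
    (hΦ₁ : Measurable (SideInformation.entries Φ₁))
    (hΦ₂ : Measurable (SideInformation.entries Φ₂))
    (hinv₁ : SideInformation.IsLeftRotationInvariant P Φ₁)
    (hinv₂ : SideInformation.IsLeftRotationInvariant P Φ₂)
    (hindep : ProbabilityTheory.IndepFun (SideInformation.entries Φ₁)
      (SideInformation.entries Φ₂) P)
    (μ : EuclideanSpace ℝ (Fin n₁ ⊕ Fin n₂))
    (C : Matrix (Fin n₁ ⊕ Fin n₂) (Fin n₁ ⊕ Fin n₂) ℝ) (hC : C.PosSemidef) :
    ∀ᵐ ω ∂P,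
      Tendsto (fun v : ℝ => SideInformation.mmseSide (Φ₁ ω) (Φ₂ ω) μ C v) (𝓝[>] 0) (𝓝 0) ↔
        (C.toBlocks₁₁.rank ≤ m₁ ∨
          (C.rank - C.toBlocks₂₂.rank ≤ m₁ ∧ C.rank ≤ m₁ + m₂)) := by
  -- Marginal densities alone would not give this; independence makes the joint law a product.
  have hac : P.map (fun ω => (SideInformation.entries Φ₁ ω, SideInformation.entries Φ₂ ω)) ≪
      (volume : Measure ((Fin m₁ → Fin n₁ → ℝ) × (Fin m₂ → Fin n₂ → ℝ))) := by
    rw [(indepFun_iff_map_prod_eq_prod_map_map hΦ₁.aemeasurable hΦ₂.aemeasurable).1 hindep]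
    exact (SideInformation.map_entries_absolutelyContinuous hinv₁).prod
      (SideInformation.map_entries_absolutelyContinuous hinv₂)
  exact ae_of_ae_map (hΦ₁.prodMk hΦ₂).aemeasurable
    (hac.ae_le (SideInformation.ae_tendsto_mmseSide_iff μ hC))
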